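/- Let $V$ be a finite set with $|V| = p^k$, where $p$ is prime and $k \ge 1$, and let $\mathbf{G}(V)$ be the set of simple undirected graphs with vertex set $V$. Let $h \colon \mathbf{G}(V) \to \{0,1\}$ be a graph property (that is, $h(G) = h(G')$ whenever $G$ and $G'$ are isomorphic) which is nontrivial (not constant) and monotone, i.e. either monotone increasing ($h(G') \le h(G)$ whenever $E(G') \subseteq E(G)$) or monotone decreasing ($h(G') \ge h(G)$ whenever $E(G') \subseteq E(G)$). Then $h$ is evasive: its decision-tree complexity $D(h)$ equals $\binom{p^k}{2}$. Here a decision tree is a binary tree in which each internal node queries whether a given pair of distinct vertices is an edge of the input graph, with one subtree for each answer, and each leaf carries an output in $\{0,1\}$; and $D(h)$ is the least depth (maximal number of queries on a path from the root to a leaf) of a decision tree that outputs $h(G)$ for every $G \in \mathbf{G}(V)$. -/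

import Mathlib

/-- A potential edge on the vertex set `V`: an unordered pair of distinct vertices. -/
abbrev PotentialEdge (V : Type*) : Type _ := {e : Sym2 V // ¬ e.IsDiag}

/-- A binary decision tree on graphs with vertex set `V`: an internal node queries a pair of
distinct vertices and has one subtree for the answer "not an edge" and one for the answer
"an edge"; a leaf carries the output value. -/
inductive DecisionTree (V : Type*) where
  | leaf (b : Bool) : DecisionTree V
  | query (e : PotentialEdge V) (no yes : DecisionTree V) : DecisionTree V

namespace DecisionTree

open Classical in
/-- The output of a decision tree on the graph `G`. -/
noncomputable def eval {V : Type*} : DecisionTree V → SimpleGraph V → Bool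
  | leaf b, _ => b
  | query e no yes, G => if (e : Sym2 V) ∈ G.edgeSet then yes.eval G else no.eval G

/-- The depth: the largest number of queries on a path from the root to a leaf. -/
def depth {V : Type*} : DecisionTree V → ℕ
  | leaf _ => 0
  | query _ no yes => max no.depth yes.depth + 1

/-- The tree computes the function `h` correctly on every graph. -/
def Computes {V : Type*} (T : DecisionTree V) (h : SimpleGraph V → Bool) : Prop :=
  ∀ G : SimpleGraph V, T.eval G = h G

end DecisionTree

/-- The decision-tree complexity `D(h)`: the least depth of a decision tree computing `h`.
For finite `V` the set is nonempty, see `exists_computes_depth_le`. -/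
noncomputable def decisionTreeComplexity {V : Type*} (h : SimpleGraph V → Bool) : ℕ :=
  sInf {d : ℕ | ∃ T : DecisionTree V, T.Computes h ∧ T.depth = d}

/-- `h` is evasive if its decision-tree complexity is the number of all pairs of vertices. -/
def IsEvasive {V : Type*} [Fintype V] (h : SimpleGraph V → Bool) : Prop :=
  decisionTreeComplexity h = (Fintype.card V).choose 2

/-- `h` is a graph property over `V`: it takes the same value on isomorphic graphs. -/
def IsGraphProperty {V : Type*} (h : SimpleGraph V → Bool) : Prop :=
  ∀ G G' : SimpleGraph V, Nonempty (G ≃g G') → h G = h G'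

/-- `h` is monotone increasing: a graph has at least the value of each of its subgraphs. -/
def IsMonotoneIncreasing {V : Type*} (h : SimpleGraph V → Bool) : Prop :=
  ∀ G' G : SimpleGraph V, G'.edgeSet ⊆ G.edgeSet → h G' ≤ h G

/-- `h` is monotone decreasing: a graph has at most the value of each of its subgraphs. -/
def IsMonotoneDecreasing {V : Type*} (h : SimpleGraph V → Bool) : Prop :=
  ∀ G' G : SimpleGraph V, G'.edgeSet ⊆ G.edgeSet → h G ≤ h G'

/-- `h` is nontrivial: it is not constant. -/
def IsNontrivialProperty {V : Type*} (h : SimpleGraph V → Bool) : Prop :=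
  ∃ G G' : SimpleGraph V, h G ≠ h G'

theorem exists_computes_of_dependsOn {V : Type*} (s : Finset (PotentialEdge V)) :
    ∀ h : SimpleGraph V → Bool,
      (∀ G G' : SimpleGraph V,
        (∀ e ∈ s, (e : Sym2 V) ∈ G.edgeSet ↔ (e : Sym2 V) ∈ G'.edgeSet) → h G = h G') →
      ∃ T : DecisionTree V, T.Computes h ∧ T.depth ≤ s.card := by
  classical
  induction s using Finset.induction_on with
  | empty =>
    intro h hh
    exact ⟨.leaf (h ⊥), fun G => hh _ _ (by simp), by simp [DecisionTree.depth]⟩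
  | insert e s he ih =>
    intro h hh
    obtain ⟨T₀, h₀, d₀⟩ := ih (fun G => h (G.deleteEdges {(e : Sym2 V)})) (by
      intro G G' hG
      apply hh
      intro f hf
      rcases Finset.mem_insert.1 hf with rfl | hf
      · simp
      · simp [hG f hf])
    obtain ⟨T₁, h₁, d₁⟩ := ih (fun G => h (G ⊔ SimpleGraph.fromEdgeSet {(e : Sym2 V)})) (by
      intro G G' hG
      apply hh
      intro f hf
      rcases Finset.mem_insert.1 hf with rfl | hf
      · simp [f.2]
      · simp [hG f hf])
    refine ⟨.query e T₀ T₁, fun G => ?_, ?_⟩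
    · rw [DecisionTree.eval]
      split_ifs with hG
      · rw [h₁ G]
        apply hh
        intro f _
        by_cases hfe : (f : Sym2 V) = e
        · simp [hfe, hG, e.2]
        · simp [hfe]
      · rw [h₀ G]
        apply hh
        intro f _
        by_cases hfe : (f : Sym2 V) = e
        · simp [hfe, hG]
        · simp [hfe]
    · rw [Finset.card_insert_of_notMem he, DecisionTree.depth]
      omega

/-- Every function on the graphs with finite vertex set `V` is computed by some decision tree of
depth at most `|V|` choose 2. -/
theorem exists_computes_depth_le {V : Type*} [Fintype V] (h : SimpleGraph V → Bool) :
    ∃ T : DecisionTree V, T.Computes h ∧ T.depth ≤ (Fintype.card V).choose 2 := by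
  classical
  obtain ⟨T, hT, hd⟩ := exists_computes_of_dependsOn (Finset.univ : Finset (PotentialEdge V)) h
    (by
      intro G G' hG
      have : G = G' := by
        apply SimpleGraph.edgeSet_injective
        ext e
        by_cases he : e.IsDiag
        · exact ⟨fun h' => absurd he (G.not_isDiag_of_mem_edgeSet h'),
            fun h' => absurd he (G'.not_isDiag_of_mem_edgeSet h')⟩
        · exact hG ⟨e, he⟩ (Finset.mem_univ _)
      rw [this])
  refine ⟨T, hT, hd.trans (le_of_eq ?_)⟩
  rw [Finset.card_univ, Sym2.card_subtype_not_diag]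

/-!
A decision tree that computes `h` with fewer than `|V|` choose `2` queries leaves some edge
unqueried on every path. Let `F` be the simplicial complex of the edge sets on which `h` agrees with
its value at the empty graph; by monotonicity it is closed under subsets. Splitting `F` at the edge
queried first, into its deletion and the star of that edge, which meet in the link, shows by
induction on the tree that the poset of nonempty faces of `F` has no reduced homology
(`DecisionTree.eq_empty_or_acyclic`).

Identify `V` with the field `K` of `p ^ k` elements. The affine group of `K` permutes the vertices
and so acts on the poset of nonempty faces. Translations have order dividing `p`, and Smith's theorem
(`OrderChain.Acyclic.fixedPoints`), applied to one translation after another, shows that the poset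
of translation-invariant faces is still acyclic mod `p`. Multiplication by a generator of the
cyclic group of units acts on it, and has a fixed point by the Lefschetz fixed point theorem
(`OrderChain.Acyclic.exists_fixedPoint`). This fixed face is a nonempty set of edges invariant under
the affine group, which is transitive on edges; so it consists of all edges, and `h` takes the same
value on the empty and the complete graph, which is impossible for a nontrivial monotone `h`.

Homology is that of order complexes. It is computed with strictly decreasing lists in the poset, the
empty list included, inside the free module on all lists with the boundary
`∂ (x :: l) = l - x :: ∂ l`. An order automorphism that fixes a chain fixes each of its entries, so
no orientation signs occur: the fixed lists are the chains of the fixed poset, which is what both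
Smith's theorem and the trace computation need.
-/

/-! ### Chains in a poset and their boundary -/

namespace OrderChain

section Boundary

variable {X : Type*} (R : Type*) [CommRing R]

/-- The boundary of a single list: the alternating sum of the lists obtained by deleting one
entry. The boundary of a one-entry list is the empty list, so the complex is augmented. -/
noncomputable def boundaryList : List X → (List X →₀ R)
  | [] => 0
  | x :: l => Finsupp.single l 1 - Finsupp.lmapDomain R R (List.cons x) (boundaryList l)

/-- The linear extension of `boundaryList`. -/
noncomputable def boundary : (List X →₀ R) →ₗ[R] (List X →₀ R) :=
  Finsupp.linearCombination R (boundaryList R)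

variable {R}

theorem boundary_single (l : List X) (c : R) :
    boundary R (Finsupp.single l c) = c • boundaryList R l := by
  simp [boundary, Finsupp.linearCombination_single]

theorem boundary_cons (x : X) (z : List X →₀ R) :
    boundary R (Finsupp.lmapDomain R R (List.cons x) z) =
      z - Finsupp.lmapDomain R R (List.cons x) (boundary R z) := by
  induction z using Finsupp.induction_linear with
  | zero => simp
  | add f g hf hg => simp only [map_add, hf, hg]; abel
  | single l c =>
    rw [Finsupp.lmapDomain_apply, Finsupp.mapDomain_single, boundary_single, boundary_single,
      boundaryList, map_smul, smul_sub]
    simp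

theorem boundary_boundary (z : List X →₀ R) : boundary R (boundary R z) = 0 := by
  have key : ∀ l : List X, boundary R (boundaryList R l) = 0 := by
    intro l
    induction l with
    | nil => simp [boundaryList]
    | cons x l ih =>
      rw [boundaryList, map_sub, boundary_cons, ih, boundary_single]
      simp
  induction z using Finsupp.induction_linear with
  | zero => simp
  | add f g hf hg => simp [hf, hg]
  | single l c => rw [boundary_single, map_smul, key, smul_zero]

theorem boundaryList_mem (l : List X) :
    boundaryList R l ∈ Finsupp.supported R R {m | m.Sublist l ∧ m.length + 1 = l.length} := by
  induction l with
  | nil => simp [boundaryList]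
  | cons x l ih =>
    rw [boundaryList]
    refine Submodule.sub_mem _ (Finsupp.single_mem_supported R _ ⟨by simp, by simp⟩) ?_
    refine Finsupp.supported_mono ?_
      (show _ ∈ Finsupp.supported R R
        (List.cons x '' {m | m.Sublist l ∧ m.length + 1 = l.length}) by
      rw [← Finsupp.lmapDomain_supported]
      exact Submodule.mem_map_of_mem ih)
    rintro _ ⟨m, ⟨h1, h2⟩, rfl⟩
    exact ⟨h1.cons_cons x, by simp [h2]⟩

/-- A linear map that is compatible with supports on basis vectors is so on all vectors. -/
theorem map_mem_supported {α β : Type*} {s : Set α} {t : Set β}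
    (φ : (α →₀ R) →ₗ[R] (β →₀ R))
    (h : ∀ a ∈ s, φ (Finsupp.single a 1) ∈ Finsupp.supported R R t)
    {z : α →₀ R} (hz : z ∈ Finsupp.supported R R s) : φ z ∈ Finsupp.supported R R t := by
  rw [Finsupp.supported_eq_span_single] at hz
  refine (Submodule.span_le.2 ?_ : _ ≤ (Finsupp.supported R R t).comap φ) hz
  rintro _ ⟨a, ha, rfl⟩
  exact h a ha

theorem boundary_mem_supported {s t : Set (List X)}
    (h : ∀ l ∈ s, ∀ m, m.Sublist l → m.length + 1 = l.length → m ∈ t)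
    {z : List X →₀ R} (hz : z ∈ Finsupp.supported R R s) :
    boundary R z ∈ Finsupp.supported R R t := by
  refine map_mem_supported _ (fun l hl => ?_) hz
  rw [boundary_single, one_smul]
  exact Finsupp.supported_mono (fun m hm => h l hl m hm.1 hm.2) (boundaryList_mem l)

/-- The part of a chain carried by the lists of length at least `n`. -/
noncomputable def truncate (n : ℕ) : (List X →₀ R) →ₗ[R] (List X →₀ R) :=
  Finsupp.linearCombination R (fun l => if n ≤ l.length then Finsupp.single l 1 else 0)

theorem truncate_single (n : ℕ) (l : List X) (c : R) :
    truncate n (Finsupp.single l c) = if n ≤ l.length then Finsupp.single l c else 0 := by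
  simp only [truncate, Finsupp.linearCombination_single]
  split_ifs <;> simp

theorem truncate_of_mem {n : ℕ} {z : List X →₀ R}
    (hz : z ∈ Finsupp.supported R R {l : List X | n ≤ l.length}) : truncate n z = z := by
  rw [Finsupp.supported_eq_span_single] at hz
  refine LinearMap.eqOn_span (f := truncate n) (g := LinearMap.id) ?_ hz
  rintro _ ⟨l, hl, rfl⟩
  simpa [truncate_single] using fun h => absurd hl (not_le.2 h)

theorem truncate_mem_supported (n : ℕ) {s : Set (List X)} {z : List X →₀ R}
    (hz : z ∈ Finsupp.supported R R s) :
    truncate n z ∈ Finsupp.supported R R (s ∩ {l | n ≤ l.length}) := by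
  refine map_mem_supported _ (fun l hl => ?_) hz
  rw [truncate_single]
  split_ifs with h
  · exact Finsupp.single_mem_supported R _ ⟨hl, h⟩
  · exact Submodule.zero_mem _

theorem boundary_truncate (n : ℕ) (z : List X →₀ R) :
    boundary R (truncate (n + 1) z) = truncate n (boundary R z) := by
  induction z using Finsupp.induction_linear with
  | zero => simp
  | add f g hf hg => simp only [map_add, hf, hg]
  | single l c =>
    rw [truncate_single, boundary_single]
    split_ifs with h
    · rw [boundary_single, truncate_of_mem]
      refine Submodule.smul_mem _ _ (Finsupp.supported_mono ?_ (boundaryList_mem l))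
      rintro m ⟨-, hm⟩
      simp only [Set.mem_ofPred_eq]
      omega
    · have : truncate n (boundaryList R l) ∈ Finsupp.supported R R
          ({m | m.Sublist l ∧ m.length + 1 = l.length} ∩ {m | n ≤ m.length}) :=
        truncate_mem_supported n (boundaryList_mem l)
      have hem : ({m : List X | m.Sublist l ∧ m.length + 1 = l.length} ∩ {m | n ≤ m.length}) = ∅ := by
        ext m
        simp only [Set.mem_inter_iff, Set.mem_ofPred_eq, Set.mem_empty_iff_false, iff_false]
        omega
      rw [hem, Finsupp.supported_empty, Submodule.mem_bot] at this
      rw [map_zero, map_smul, this, smul_zero]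

end Boundary

section Acyclic

variable {X : Type*} [PartialOrder X]

/-- The strictly decreasing lists of elements of `A`, that is, the simplices of the order complex
of `A`, the empty simplex included. -/
def chains (A : Set X) : Set (List X) :=
  {l | l.Pairwise (fun a b => b < a) ∧ ∀ x ∈ l, x ∈ A}

variable (R : Type*) [CommRing R]

/-- `A` has vanishing reduced homology with coefficients in `R`: every cycle of its augmented
ordered chain complex is a boundary. -/
def Acyclic (A : Set X) : Prop :=
  ∀ z ∈ Finsupp.supported R R (chains A), boundary R z = 0 →
    ∃ w ∈ Finsupp.supported R R (chains A), boundary R w = z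

variable {R}

theorem mem_chains_of_sublist {A : Set X} {l m : List X} (hl : l ∈ chains A)
    (hm : m.Sublist l) : m ∈ chains A :=
  ⟨hl.1.sublist hm, fun x hx => hl.2 x (hm.subset hx)⟩

theorem boundary_mem_chains {A : Set X} {z : List X →₀ R}
    (hz : z ∈ Finsupp.supported R R (chains A)) :
    boundary R z ∈ Finsupp.supported R R (chains A) :=
  boundary_mem_supported (fun _ hl _ hm _ => mem_chains_of_sublist hl hm) hz

theorem chains_inter (U V : Set X) : chains (U ∩ V) = chains U ∩ chains V := by
  ext l
  simp only [chains, Set.mem_inter_iff, Set.mem_ofPred_eq]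
  grind

/-- Each of `U`, `V` being a lower set relative to the other, the largest entry of a chain decides
in which of the two it lies. -/
theorem chains_union {U V : Set X} (hU : ∀ u ∈ U, ∀ v ∈ V, v ≤ u → v ∈ U)
    (hV : ∀ v ∈ V, ∀ u ∈ U, u ≤ v → u ∈ V) : chains (U ∪ V) = chains U ∪ chains V := by
  ext l
  constructor
  · rintro ⟨h1, h2⟩
    cases l with
    | nil => exact Or.inl ⟨List.Pairwise.nil, by simp⟩
    | cons a l =>
      have hlt := (List.pairwise_cons.1 h1).1
      rcases h2 a (by simp) with ha | ha
      · refine Or.inl ⟨h1, fun x hx => ?_⟩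
        rcases List.mem_cons.1 hx with rfl | hx'
        · exact ha
        · exact (h2 x hx).elim id (fun hv => hU a ha x hv (hlt x hx').le)
      · refine Or.inr ⟨h1, fun x hx => ?_⟩
        rcases List.mem_cons.1 hx with rfl | hx'
        · exact ha
        · exact (h2 x hx).elim (fun hu => hV a ha x hu (hlt x hx').le) id
  · rintro (h | h)
    · exact ⟨h.1, fun x hx => Or.inl (h.2 x hx)⟩
    · exact ⟨h.1, fun x hx => Or.inr (h.2 x hx)⟩

/-- The part of the Mayer–Vietoris sequence that is needed. -/
theorem Acyclic.union {U V : Set X} (hU : ∀ u ∈ U, ∀ v ∈ V, v ≤ u → v ∈ U)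
    (hV : ∀ v ∈ V, ∀ u ∈ U, u ≤ v → u ∈ V) (aU : Acyclic R U) (aV : Acyclic R V)
    (aUV : Acyclic R (U ∩ V)) : Acyclic R (U ∪ V) := by
  intro z hz hz0
  rw [chains_union hU hV, Finsupp.supported_union] at hz
  obtain ⟨u, hu, v, hv, rfl⟩ := Submodule.mem_sup.1 hz
  have huv : boundary R u = - boundary R v := by
    rw [map_add] at hz0
    exact eq_neg_of_add_eq_zero_left hz0
  have hmem : boundary R u ∈ Finsupp.supported R R (chains (U ∩ V)) := by
    rw [chains_inter, Finsupp.supported_inter]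
    refine ⟨boundary_mem_chains hu, ?_⟩
    rw [huv]
    exact Submodule.neg_mem _ (boundary_mem_chains hv)
  obtain ⟨w, hw, hwb⟩ := aUV _ hmem (boundary_boundary u)
  rw [chains_inter, Finsupp.supported_inter] at hw
  obtain ⟨u', hu', hub⟩ := aU (u - w) (Submodule.sub_mem _ hu hw.1) (by rw [map_sub, hwb, sub_self])
  obtain ⟨v', hv', hvb⟩ := aV (v + w) (Submodule.add_mem _ hv hw.2) (by
    rw [map_add, hwb, huv, add_neg_cancel])
  refine ⟨u' + v', ?_, ?_⟩
  · rw [chains_union hU hV, Finsupp.supported_union]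
    exact Submodule.add_mem_sup hu' hv'
  · rw [map_add, hub, hvb]
    abel

/-- A poset with a greatest element `m` is acyclic: prepending `m` is a contraction. -/
theorem acyclic_of_isGreatest {A : Set X} {m : X} (hm : IsGreatest A m) : Acyclic R A := by
  classical
  intro z hz hz0
  let s : (List X →₀ R) →ₗ[R] (List X →₀ R) :=
    Finsupp.linearCombination R (fun l => if m ∈ l then 0 else Finsupp.single (m :: l) 1)
  have s_single : ∀ l : List X, s (Finsupp.single l 1) =
      if m ∈ l then 0 else Finsupp.single (m :: l) 1 := by
    intro l
    simp [s]
  have s_of_notMem : ∀ y ∈ Finsupp.supported R R {l : List X | m ∉ l},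
      s y = Finsupp.lmapDomain R R (List.cons m) y := by
    intro y hy
    rw [Finsupp.supported_eq_span_single] at hy
    refine LinearMap.eqOn_span ?_ hy
    rintro _ ⟨l, hl, rfl⟩
    rw [s_single, if_neg hl]
    simp
  have s_cons : ∀ y, s (Finsupp.lmapDomain R R (List.cons m) y) = 0 := by
    intro y
    induction y using Finsupp.induction_linear with
    | zero => simp
    | add f g hf hg => simp only [map_add, hf, hg, add_zero]
    | single l c => simp [s]
  have s_mem : ∀ y ∈ Finsupp.supported R R (chains A), s y ∈ Finsupp.supported R R (chains A) := by
    intro y hy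
    refine map_mem_supported _ (fun l hl => ?_) hy
    rw [s_single]
    split_ifs with h
    · exact Submodule.zero_mem _
    · refine Finsupp.single_mem_supported R _ ⟨List.pairwise_cons.2 ⟨fun x hx => ?_, hl.1⟩, ?_⟩
      · exact lt_of_le_of_ne (hm.2 (hl.2 x hx)) (fun hxm => h (hxm ▸ hx))
      · rintro x hx
        rcases List.mem_cons.1 hx with rfl | hx
        · exact hm.1
        · exact hl.2 x hx
  have homotopy : ∀ y ∈ Finsupp.supported R R (chains A),
      boundary R (s y) + s (boundary R y) = y := by
    intro y hy
    rw [Finsupp.supported_eq_span_single] at hy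
    refine LinearMap.eqOn_span (f := boundary R ∘ₗ s + s ∘ₗ boundary R) (g := LinearMap.id) ?_ hy
    rintro _ ⟨l, hl, rfl⟩
    change boundary R (s _) + s (boundary R _) = Finsupp.single l 1
    rw [s_single, boundary_single, one_smul]
    have hbd : ∀ l : List X, m ∉ l →
        boundaryList R l ∈ Finsupp.supported R R {l : List X | m ∉ l} := by
      intro l hml
      refine Finsupp.supported_mono ?_ (boundaryList_mem l)
      rintro l' ⟨hl', -⟩ hml'
      exact hml (hl'.subset hml')
    split_ifs with h
    · cases l with
      | nil => simp at h
      | cons a l =>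
        have hlt := (List.pairwise_cons.1 hl.1).1
        -- The greatest element can only be the head of a decreasing list.
        have ham : a = m := by
          rcases List.mem_cons.1 h with h | h
          · exact h.symm
          · exact absurd (hlt m h) (not_lt_of_ge (hm.2 (hl.2 a (by simp))))
        subst ham
        rw [boundaryList, map_sub, s_cons, s_single, if_neg (fun ha => lt_irrefl a (hlt a ha))]
        simp
    · rw [s_of_notMem _ (hbd l h), boundary_single, one_smul, boundaryList, sub_add_cancel]
  refine ⟨s z, s_mem z hz, ?_⟩
  simpa [hz0] using homotopy z hz

end Acyclic

end OrderChain

/-! ### Smith theory -/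

namespace OrderChain

section AbstractSmith

variable {R M : Type*} [CommRing R] [AddCommGroup M] [Module R M]

/-- For a cyclic group of order `p` acting on `C`, with `F` the fixed part, this holds for the
sum `σ = 1 + g + ⋯ + g ^ (p - 1)` and the difference `τ = 1 - g` in either order. It says that `τ`
has kernel `σ C ⊕ F` on `C`, which gives the exact sequences of Smith theory. -/
structure SmithPair (d : M →ₗ[R] M) (C F : Submodule R M) (σ τ : M →ₗ[R] M) : Prop where
  map_mem : ∀ z ∈ C, σ z ∈ C
  comm : ∀ z, d (σ z) = σ (d z)
  comp_eq_zero : ∀ z, τ (σ z) = 0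
  eq_zero_of_mem : ∀ f ∈ F, τ f = 0
  exists_of_eq_zero : ∀ z ∈ C, τ z = 0 → ∃ a ∈ C, ∃ f ∈ F, z = σ a + f
  disjoint : ∀ a ∈ C, ∀ f ∈ F, σ a = f → f = 0

variable {d : M →ₗ[R] M} {C F : Submodule R M} {σ τ : M →ₗ[R] M}

/-- The image of `τ` being acyclic above level `n`, the image of `σ` and the fixed part are
acyclic at level `n`: this is the connecting homomorphism of the Smith sequence, in elements. -/
theorem SmithPair.step (hσ : SmithPair d C F σ τ) (hτ : SmithPair d C F τ σ)
    (hdd : ∀ z, d (d z) = 0) (hdC : ∀ z ∈ C, d z ∈ C) (hdF : ∀ z ∈ F, d z ∈ F) (hFC : F ≤ C)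
    {K K' : Submodule R M} (hK' : ∀ z ∈ K', τ z ∈ K')
    (hex : ∀ z ∈ C, z ∈ K → d z = 0 → ∃ b ∈ C, b ∈ K' ∧ d b = z)
    (ih : ∀ c ∈ C, τ c ∈ K' → d (τ c) = 0 → ∃ c' ∈ C, d (τ c') = τ c)
    {a f : M} (ha : a ∈ C) (hf : f ∈ F) (hK : σ a + f ∈ K) (hz : d (σ a + f) = 0) :
    ∃ a' ∈ C, ∃ f' ∈ F, d (σ a') = σ a ∧ d f' = f := by
  obtain ⟨b, hbC, hbK, hb⟩ := hex _ (C.add_mem (hσ.map_mem a ha) (hFC hf)) hK hz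
  obtain ⟨c, hc, hcb⟩ := ih b hbC (hK' b hbK) (by
    rw [hτ.comm, hb, map_add, hσ.comp_eq_zero, hσ.eq_zero_of_mem f hf, add_zero])
  obtain ⟨a', ha', f', hf', h⟩ := hσ.exists_of_eq_zero (b - d c) (C.sub_mem hbC (hdC c hc)) (by
    rw [map_sub, ← hτ.comm, hcb, sub_self])
  have hsum : σ (d a') + d f' = σ a + f := by
    rw [← hσ.comm, ← map_add, ← h, map_sub, hdd, sub_zero, hb]
  have hff : d f' = f := by
    refine (sub_eq_zero.1 (hσ.disjoint (a - d a') (C.sub_mem ha (hdC a' ha')) (d f' - f)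
      (F.sub_mem (hdF f' hf') hf) ?_))
    rw [map_sub, sub_eq_sub_iff_add_eq_add, ← hsum, add_comm]
  refine ⟨a', ha', f', hf', ?_, hff⟩
  rw [hff] at hsum
  rw [hσ.comm]
  exact add_right_cancel hsum

/-- Smith's theorem in elements: if `C` is acyclic then so is the fixed part `F`. The filtration
`K` by degree starts the descending induction. -/
theorem SmithPair.acyclic_fixed (hσ : SmithPair d C F σ τ) (hτ : SmithPair d C F τ σ)
    (hdd : ∀ z, d (d z) = 0) (hdC : ∀ z ∈ C, d z ∈ C) (hdF : ∀ z ∈ F, d z ∈ F) (hFC : F ≤ C)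
    (K : ℕ → Submodule R M) (hKσ : ∀ n, ∀ z ∈ K n, σ z ∈ K n) (hKτ : ∀ n, ∀ z ∈ K n, τ z ∈ K n)
    (hK0 : K 0 = ⊤) {N : ℕ} (hKN : ∀ z ∈ C, z ∈ K N → z = 0)
    (hex : ∀ n, ∀ z ∈ C, z ∈ K n → d z = 0 → ∃ b ∈ C, b ∈ K (n + 1) ∧ d b = z)
    {f : M} (hf : f ∈ F) (hdf : d f = 0) : ∃ f' ∈ F, d f' = f := by
  have key : ∀ n ≤ N,
      (∀ c ∈ C, σ c ∈ K n → d (σ c) = 0 → ∃ c' ∈ C, d (σ c') = σ c) ∧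
      (∀ c ∈ C, τ c ∈ K n → d (τ c) = 0 → ∃ c' ∈ C, d (τ c') = τ c) := by
    intro n hn
    induction hn using Nat.decreasingInduction with
    | self =>
      refine ⟨fun c hc hcK _ => ⟨0, C.zero_mem, ?_⟩, fun c hc hcK _ => ⟨0, C.zero_mem, ?_⟩⟩
      · rw [hKN _ (hσ.map_mem c hc) hcK, map_zero, map_zero]
      · rw [hKN _ (hτ.map_mem c hc) hcK, map_zero, map_zero]
    | of_succ n hn ih =>
      refine ⟨fun c hc hcK hc0 => ?_, fun c hc hcK hc0 => ?_⟩
      · obtain ⟨a', ha', _, _, h, _⟩ := hσ.step hτ hdd hdC hdF hFC (hKτ (n + 1)) (hex n) ih.2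
          hc F.zero_mem (by rwa [add_zero]) (by rwa [add_zero])
        exact ⟨a', ha', h⟩
      · obtain ⟨a', ha', _, _, h, _⟩ := hτ.step hσ hdd hdC hdF hFC (hKσ (n + 1)) (hex n) ih.1
          hc F.zero_mem (by rwa [add_zero]) (by rwa [add_zero])
        exact ⟨a', ha', h⟩
  -- The level `1` is all that is needed, the whole of `F` lying in level `0`.
  have ih : ∀ c ∈ C, τ c ∈ K 1 → d (τ c) = 0 → ∃ c' ∈ C, d (τ c') = τ c := by
    rcases Nat.eq_zero_or_pos N with rfl | hN
    · intro c hc _ _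
      refine ⟨0, C.zero_mem, ?_⟩
      rw [hKN _ (hτ.map_mem c hc) (by simp [hK0]), map_zero, map_zero]
    · exact (key 1 hN).2
  obtain ⟨_, _, f', hf', _, h⟩ := hσ.step hτ hdd hdC hdF hFC (hKτ 1) (hex 0) ih
    C.zero_mem hf (by simp [hK0]) (by simpa using hdf)
  exact ⟨f', hf', h⟩

end AbstractSmith

section PrimeOrder

variable {α : Type*} {p : ℕ} [hp : Fact p.Prime] {e : Equiv.Perm α}

/-- For `e ^ p = 1`, a weight function that picks one point of each nontrivial orbit of `e`. -/
theorem exists_orbit_weight (he : e ^ p = 1) : ∃ w : α → ZMod p,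
    ∀ l, e l ≠ l → ∑ i ∈ Finset.range p, w ((e ^ i) l) = 1 := by
  classical
  let r : α → α := fun l => (Quotient.mk (Equiv.Perm.SameCycle.setoid e) l).out
  have hr : ∀ l, e.SameCycle (r l) l := fun l =>
    Quotient.exact (s := Equiv.Perm.SameCycle.setoid e) (Quotient.out_eq _)
  have hrr : ∀ l m, e.SameCycle l m → r l = r m := fun l m h =>
    congrArg Quotient.out (Quotient.sound (s := Equiv.Perm.SameCycle.setoid e) h)
  refine ⟨fun l => if e l ≠ l ∧ r l = l then 1 else 0, fun l hl => ?_⟩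
  have hne : ∀ i : ℕ, e ((e ^ i) l) ≠ (e ^ i) l := by
    intro i h
    apply hl
    apply (e ^ i).injective
    rw [← h, ← Equiv.Perm.mul_apply, ← Equiv.Perm.mul_apply, ← pow_succ, ← pow_succ']
  have hmin : Function.minimalPeriod e l = p := by
    refine (Nat.dvd_prime hp.out).1 (Function.IsPeriodicPt.minimalPeriod_dvd ?_)
      |>.resolve_left ?_
    · rw [Function.IsPeriodicPt, Function.IsFixedPt, Equiv.Perm.iterate_eq_pow, he,
        Equiv.Perm.one_apply]
    · rw [Function.minimalPeriod_eq_one_iff_isFixedPt]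
      exact hl
  obtain ⟨i₀, hi₀, hl₀⟩ : ∃ i < p, (e ^ i) l = r l := by
    obtain ⟨j, hj⟩ := (hr l).symm
    have hp0 : (0 : ℤ) < p := by exact_mod_cast hp.out.pos
    refine ⟨(j % p).toNat, ?_, ?_⟩
    · have := Int.emod_lt_of_pos j hp0
      omega
    · rw [← hj, zpow_eq_zpow_emod (n := p) j (by exact_mod_cast he), ← zpow_natCast,
        Int.toNat_of_nonneg (Int.emod_nonneg _ hp0.ne')]
  rw [Finset.sum_eq_single_of_mem i₀ (Finset.mem_range.2 hi₀)]
  · refine if_pos ⟨hne i₀, ?_⟩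
    rw [hrr _ l ⟨-i₀, by simp⟩, hl₀]
  · intro i hi hii
    refine if_neg ?_
    rintro ⟨-, h⟩
    rw [hrr _ l ⟨-i, by simp⟩, ← hl₀] at h
    apply hii
    refine Function.iterate_injOn_Iio_minimalPeriod (f := e) (x := l) ?_ ?_ ?_
    · simpa [hmin] using hi
    · simpa [hmin] using hi₀
    · simpa [Equiv.Perm.iterate_eq_pow] using h.symm

variable (p) in
/-- The action of a permutation of the basis on finitely supported functions. -/
noncomputable def shift (e : Equiv.Perm α) : Module.End (ZMod p) (α →₀ ZMod p) :=
  Finsupp.lmapDomain (ZMod p) (ZMod p) e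

theorem shift_pow_apply (i : ℕ) (z : α →₀ ZMod p) (l : α) :
    (shift p e ^ i) z l = z ((e ^ i)⁻¹ l) := by
  induction i generalizing z with
  | zero => simp
  | succ i ih =>
    rw [pow_succ, Module.End.mul_apply, ih, shift, Finsupp.lmapDomain_apply,
      Finsupp.mapDomain_equiv_apply, pow_succ, mul_inv_rev, Equiv.Perm.mul_apply]
    rfl

variable (p) in
/-- The sum of the first `p` powers of the action of a permutation. -/
noncomputable def orbitSum (e : Equiv.Perm α) : Module.End (ZMod p) (α →₀ ZMod p) :=
  ∑ i ∈ Finset.range p, shift p e ^ i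

theorem shift_pow_prime (he : e ^ p = 1) : shift p e ^ p = 1 := by
  ext1 l
  ext m
  simp [shift_pow_apply, he]

theorem one_sub_shift_mul_orbitSum (he : e ^ p = 1) : (1 - shift p e) * orbitSum p e = 0 := by
  refine (mul_neg_geom_sum (shift p e) p).trans ?_
  rw [shift_pow_prime he]
  exact sub_self _

theorem orbitSum_mul_one_sub_shift (he : e ^ p = 1) : orbitSum p e * (1 - shift p e) = 0 := by
  refine (geom_sum_mul_neg (shift p e) p).trans ?_
  rw [shift_pow_prime he]
  exact sub_self _

theorem orbitSum_eq_sum_shift_pow_sub (he : e ^ p = 1) :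
    orbitSum p e = ∑ i ∈ Finset.range p, shift p e ^ (p - i) := by
  have h1 : shift p e * orbitSum p e = orbitSum p e := by
    refine LinearMap.ext fun z => ?_
    exact (sub_eq_zero.1 (LinearMap.congr_fun (one_sub_shift_mul_orbitSum (p := p) he) z)).symm
  rw [← h1]
  nth_rewrite 1 [orbitSum]
  rw [← Finset.sum_range_reflect, Finset.mul_sum]
  refine Finset.sum_congr rfl fun i hi => ?_
  rw [← pow_succ']
  congr 1
  have := Finset.mem_range.1 hi
  omega

variable {S : Set α}

theorem pow_apply_mem_iff (hS : ∀ l, e l ∈ S ↔ l ∈ S) (i : ℕ) (l : α) :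
    (e ^ i)⁻¹ l ∈ S ↔ l ∈ S := by
  have h : ∀ m, (e ^ i) m ∈ S ↔ m ∈ S := by
    intro m
    induction i with
    | zero => simp
    | succ i ih => rw [pow_succ', Equiv.Perm.mul_apply, hS, ih]
  rw [← h, ← Equiv.Perm.mul_apply, mul_inv_cancel, Equiv.Perm.one_apply]

theorem shift_pow_mem (hS : ∀ l, e l ∈ S ↔ l ∈ S) (i : ℕ) {z : α →₀ ZMod p}
    (hz : z ∈ Finsupp.supported (ZMod p) (ZMod p) S) :
    (shift p e ^ i) z ∈ Finsupp.supported (ZMod p) (ZMod p) S := by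
  rw [Finsupp.mem_supported'] at hz ⊢
  intro l hl
  rw [shift_pow_apply]
  exact hz _ (mt (pow_apply_mem_iff hS i l).1 hl)

theorem one_sub_shift_mem (hS : ∀ l, e l ∈ S ↔ l ∈ S) {z : α →₀ ZMod p}
    (hz : z ∈ Finsupp.supported (ZMod p) (ZMod p) S) :
    (1 - shift p e) z ∈ Finsupp.supported (ZMod p) (ZMod p) S := by
  have := shift_pow_mem hS 1 hz
  rw [pow_one] at this
  exact Submodule.sub_mem _ hz this

theorem orbitSum_mem (hS : ∀ l, e l ∈ S ↔ l ∈ S) {z : α →₀ ZMod p}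
    (hz : z ∈ Finsupp.supported (ZMod p) (ZMod p) S) :
    orbitSum p e z ∈ Finsupp.supported (ZMod p) (ZMod p) S := by
  rw [orbitSum, LinearMap.sum_apply]
  exact Submodule.sum_mem _ fun i _ => shift_pow_mem hS i hz

theorem pow_inv_apply_of_fixed {l : α} (hl : e l = l) (i : ℕ) : (e ^ i)⁻¹ l = l := by
  rw [Equiv.Perm.inv_eq_iff_eq]
  induction i with
  | zero => simp
  | succ i ih => rw [pow_succ, Equiv.Perm.mul_apply, hl, ← ih]

theorem orbitSum_apply_of_fixed (z : α →₀ ZMod p) {l : α} (hl : e l = l) : orbitSum p e z l = 0 := by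
  rw [orbitSum, LinearMap.sum_apply, Finsupp.finsetSum_apply]
  -- All `p` terms equal `z l`, and `p = 0` in `ZMod p`.
  simp [shift_pow_apply, pow_inv_apply_of_fixed hl]

theorem one_sub_shift_apply_of_fixed (z : α →₀ ZMod p) {l : α} (hl : e l = l) :
    (1 - shift p e) z l = 0 := by
  have h := shift_pow_apply (p := p) (e := e) 1 z l
  rw [pow_inv_apply_of_fixed hl, pow_one] at h
  rw [LinearMap.sub_apply, Finsupp.sub_apply, h, Module.End.one_apply, sub_self]

theorem shift_apply_of_mem_fixed {z : α →₀ ZMod p}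
    (hz : z ∈ Finsupp.supported (ZMod p) (ZMod p) {l | l ∈ S ∧ e l = l}) : shift p e z = z := by
  rw [Finsupp.supported_eq_span_single] at hz
  refine LinearMap.eqOn_span (f := shift p e) (g := LinearMap.id) ?_ hz
  rintro _ ⟨l, hl, rfl⟩
  simp [shift, hl.2]

theorem orbitSum_apply_of_mem_fixed {z : α →₀ ZMod p}
    (hz : z ∈ Finsupp.supported (ZMod p) (ZMod p) {l | l ∈ S ∧ e l = l}) : orbitSum p e z = 0 := by
  have h : ∀ i, (shift p e ^ i) z = z := by
    intro i
    induction i with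
    | zero => simp
    | succ i ih => rw [pow_succ, Module.End.mul_apply, shift_apply_of_mem_fixed hz, ih]
  rw [orbitSum, LinearMap.sum_apply, Finset.sum_congr rfl fun i _ => h i]
  ext l
  simp

/-- Conjugating multiplication by an orbit weight with the powers of the shift gives operators that
add up to the identity off the fixed points. -/
theorem exists_weight_operator (S : Set α) (he : e ^ p = 1) :
    ∃ W : Module.End (ZMod p) (α →₀ ZMod p),
      (∀ z ∈ Finsupp.supported (ZMod p) (ZMod p) S,
        W z ∈ Finsupp.supported (ZMod p) (ZMod p) S) ∧
      ∀ z ∈ Finsupp.supported (ZMod p) (ZMod p) S,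
        z - ∑ i ∈ Finset.range p, (shift p e ^ (p - i)) (W ((shift p e ^ i) z)) ∈
          Finsupp.supported (ZMod p) (ZMod p) {l | l ∈ S ∧ e l = l} := by
  obtain ⟨w, hw1⟩ := exists_orbit_weight (p := p) he
  let W : Module.End (ZMod p) (α →₀ ZMod p) :=
    Finsupp.linearCombination (ZMod p) (fun l => Finsupp.single l (w l))
  have hW : ∀ z l, W z l = w l * z l := by
    intro z l
    induction z using Finsupp.induction_linear with
    | zero => simp
    | add f g hf hg => rw [map_add, Finsupp.add_apply, hf, hg, Finsupp.add_apply, mul_add]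
    | single m c =>
      by_cases h : m = l
      · subst h
        simp [W, mul_comm]
      · simp [W, h]
  have hval : ∀ z l, (∑ i ∈ Finset.range p, (shift p e ^ (p - i)) (W ((shift p e ^ i) z))) l =
      (∑ i ∈ Finset.range p, w ((e ^ i) l)) * z l := by
    intro z l
    rw [Finsupp.finsetSum_apply, Finset.sum_mul]
    refine Finset.sum_congr rfl fun i hi => ?_
    have hinv : (e ^ (p - i))⁻¹ = e ^ i := by
      rw [inv_eq_iff_mul_eq_one, ← pow_add, Nat.sub_add_cancel (Finset.mem_range.1 hi).le, he]
    rw [shift_pow_apply, hW, shift_pow_apply, hinv, ← Equiv.Perm.mul_apply, inv_mul_cancel,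
      Equiv.Perm.one_apply]
  refine ⟨W, fun z hz => ?_, fun z hz => ?_⟩
  · rw [Finsupp.mem_supported'] at hz ⊢
    intro l hl
    rw [hW, hz l hl, mul_zero]
  · rw [Finsupp.mem_supported'] at hz ⊢
    intro l hl
    rw [Finsupp.sub_apply, hval]
    by_cases h : e l = l
    · rw [hz l (fun h' => hl ⟨h', h⟩), mul_zero, sub_zero]
    · rw [hw1 l h, one_mul, sub_self]

theorem smithPair_orbitSum (hS : ∀ l, e l ∈ S ↔ l ∈ S) (he : e ^ p = 1)
    {d : (α →₀ ZMod p) →ₗ[ZMod p] (α →₀ ZMod p)} (hd : ∀ z, d (shift p e z) = shift p e (d z)) :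
    SmithPair d (Finsupp.supported (ZMod p) (ZMod p) S)
      (Finsupp.supported (ZMod p) (ZMod p) {l | l ∈ S ∧ e l = l})
      (orbitSum p e) (1 - shift p e) where
  map_mem z hz := orbitSum_mem hS hz
  comm z := by
    rw [orbitSum, LinearMap.sum_apply, LinearMap.sum_apply, map_sum]
    refine Finset.sum_congr rfl fun i hi => ?_
    clear hi
    induction i with
    | zero => simp
    | succ i ih => rw [pow_succ', Module.End.mul_apply, hd, ih, Module.End.mul_apply]
  comp_eq_zero z := LinearMap.congr_fun (one_sub_shift_mul_orbitSum he) z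
  eq_zero_of_mem f hf := by
    rw [LinearMap.sub_apply, shift_apply_of_mem_fixed hf, Module.End.one_apply, sub_self]
  exists_of_eq_zero z hz hz0 := by
    obtain ⟨W, hW, hsum⟩ := exists_weight_operator (p := p) S he
    have hz1 : shift p e z = z := (sub_eq_zero.1 hz0).symm
    have hz2 : ∀ i, (shift p e ^ i) z = z := by
      intro i
      induction i with
      | zero => simp
      | succ i ih => rw [pow_succ, Module.End.mul_apply, hz1, ih]
    refine ⟨W z, hW z hz, _, hsum z hz, ?_⟩
    simp only [hz2]
    rw [orbitSum_eq_sum_shift_pow_sub he, LinearMap.sum_apply, add_sub_cancel]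
  disjoint a ha f hf haf := by
    ext l
    by_cases h : e l = l
    · rw [← haf, orbitSum_apply_of_fixed a h, Finsupp.zero_apply]
    · exact (Finsupp.mem_supported' _ _).1 hf l (fun h' => h h'.2)

theorem smithPair_one_sub_shift (hS : ∀ l, e l ∈ S ↔ l ∈ S) (he : e ^ p = 1)
    {d : (α →₀ ZMod p) →ₗ[ZMod p] (α →₀ ZMod p)} (hd : ∀ z, d (shift p e z) = shift p e (d z)) :
    SmithPair d (Finsupp.supported (ZMod p) (ZMod p) S)
      (Finsupp.supported (ZMod p) (ZMod p) {l | l ∈ S ∧ e l = l})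
      (1 - shift p e) (orbitSum p e) where
  map_mem z hz := one_sub_shift_mem hS hz
  comm z := by
    rw [LinearMap.sub_apply, map_sub, hd, LinearMap.sub_apply]
    rfl
  comp_eq_zero z := LinearMap.congr_fun (orbitSum_mul_one_sub_shift he) z
  eq_zero_of_mem f hf := orbitSum_apply_of_mem_fixed hf
  exists_of_eq_zero z hz hz0 := by
    obtain ⟨W, hW, hsum⟩ := exists_weight_operator (p := p) S he
    refine ⟨-∑ i ∈ Finset.range p, ∑ j ∈ Finset.range (p - i),
      (shift p e ^ j) (W ((shift p e ^ i) z)), ?_, _, hsum z hz, ?_⟩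
    · exact Submodule.neg_mem _ (Submodule.sum_mem _ fun i _ => Submodule.sum_mem _ fun j _ =>
        shift_pow_mem hS j (hW _ (shift_pow_mem hS i hz)))
    · -- `(1 - g) (1 + g + ⋯ + g ^ (p - i - 1)) = 1 - g ^ (p - i)`, and the terms without a power
      -- of `g` add up to the weight operator applied to the sum of the translates of `z`, which is zero.
      have hgeom : ∀ i, (1 - shift p e) (∑ j ∈ Finset.range (p - i),
          (shift p e ^ j) (W ((shift p e ^ i) z))) =
          W ((shift p e ^ i) z) - (shift p e ^ (p - i)) (W ((shift p e ^ i) z)) := by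
        intro i
        rw [← LinearMap.sum_apply]
        exact LinearMap.congr_fun (mul_neg_geom_sum (shift p e) (p - i)) _
      have hsum0 : ∑ i ∈ Finset.range p, W ((shift p e ^ i) z) = 0 := by
        rw [← map_sum, ← LinearMap.sum_apply]
        exact (congrArg W hz0).trans (map_zero W)
      rw [map_neg, map_sum, Finset.sum_congr rfl fun i _ => hgeom i, Finset.sum_sub_distrib, hsum0]
      abel
  disjoint a ha f hf haf := by
    ext l
    by_cases h : e l = l
    · rw [← haf, one_sub_shift_apply_of_fixed a h, Finsupp.zero_apply]
    · exact (Finsupp.mem_supported' _ _).1 hf l (fun h' => h h'.2)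

end PrimeOrder

section Action

variable {X : Type*}

theorem boundary_lmapDomain_map {R Y : Type*} [CommRing R] (f : X → Y) (z : List X →₀ R) :
    boundary R (Finsupp.lmapDomain R R (List.map f) z) =
      Finsupp.lmapDomain R R (List.map f) (boundary R z) := by
  have key : ∀ l : List X, boundaryList R (l.map f) =
      Finsupp.lmapDomain R R (List.map f) (boundaryList R l) := by
    intro l
    induction l with
    | nil => simp [boundaryList]
    | cons x l ih =>
      rw [List.map_cons, boundaryList, ih, boundaryList, map_sub]
      simp only [Finsupp.lmapDomain_apply, Finsupp.mapDomain_single, ← Finsupp.mapDomain_comp]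
      rfl
  induction z using Finsupp.induction_linear with
  | zero => simp
  | add f g hf hg => simp only [map_add, hf, hg]
  | single l c =>
    rw [Finsupp.lmapDomain_apply, Finsupp.mapDomain_single, boundary_single, boundary_single, key,
      map_smul]

theorem map_eq_self_iff (g : X → X) (l : List X) : l.map g = l ↔ ∀ x ∈ l, g x = x := by
  induction l with
  | nil => simp
  | cons a l ih => simp [ih]

variable [PartialOrder X]

theorem map_mem_chains_iff {A : Set X} (g : X ≃o X) (hA : ∀ x, g x ∈ A ↔ x ∈ A) (l : List X) :
    l.map g ∈ chains A ↔ l ∈ chains A := by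
  simp [chains, List.pairwise_map, hA]

theorem length_le_card_of_mem_chains [Finite X] {A : Set X} {l : List X} (hl : l ∈ chains A) :
    l.length ≤ Nat.card X := by
  have := Fintype.ofFinite X
  rw [Nat.card_eq_fintype_card]
  exact List.Nodup.length_le_card (hl.1.imp fun h => h.ne')

/-- Smith's theorem for order complexes: the fixed points of an automorphism `g` with `g ^ p = 1`,
`p` prime, of a finite poset that is acyclic mod `p` form a poset that is acyclic mod `p`. -/
theorem Acyclic.fixedPoints [Finite X] {p : ℕ} [Fact p.Prime] {A : Set X} (g : X ≃o X)
    (hg : ∀ x, g^[p] x = x) (hA : ∀ x, g x ∈ A ↔ x ∈ A) (h : Acyclic (ZMod p) A) :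
    Acyclic (ZMod p) {x | x ∈ A ∧ g x = x} := by
  let e : Equiv.Perm (List X) := Equiv.listEquivOfEquiv g.toEquiv
  have e_apply : ∀ l, e l = l.map g := fun l => rfl
  have he : e ^ p = 1 := by
    ext1 l
    have : ∀ i, (e ^ i) l = l.map (g^[i]) := by
      intro i
      induction i with
      | zero => simp
      | succ i ih =>
        rw [pow_succ', Equiv.Perm.mul_apply, ih, e_apply, List.map_map, Function.iterate_succ']
    rw [this, Equiv.Perm.one_apply, map_eq_self_iff]
    exact fun x _ => hg x
  have hS : ∀ l, e l ∈ chains A ↔ l ∈ chains A := map_mem_chains_iff g hA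
  have hfix : chains {x | x ∈ A ∧ g x = x} = {l | l ∈ chains A ∧ e l = l} := by
    ext l
    simp only [Set.mem_ofPred_eq, e_apply, map_eq_self_iff, chains]
    grind
  have hd : ∀ z, boundary (ZMod p) (shift p e z) = shift p e (boundary (ZMod p) z) :=
    boundary_lmapDomain_map (R := ZMod p) g
  have hlen : ∀ n l, e l ∈ {l : List X | n ≤ l.length} ↔ l ∈ {l : List X | n ≤ l.length} := by
    intro n l
    simp [e_apply]
  intro z hz hz0
  rw [hfix] at hz ⊢
  refine (smithPair_orbitSum hS he hd).acyclic_fixed (smithPair_one_sub_shift hS he hd)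
    boundary_boundary (fun _ => boundary_mem_chains) ?_ (Finsupp.supported_mono fun l hl => hl.1)
    (fun n => Finsupp.supported (ZMod p) (ZMod p) {l : List X | n ≤ l.length})
    (fun n _ => orbitSum_mem (hlen n)) (fun n _ => one_sub_shift_mem (hlen n)) ?_
    (N := Nat.card X + 1) ?_ ?_ hz hz0
  · rw [← hfix]
    exact fun _ => boundary_mem_chains
  · simp
  · intro z hz hz'
    rw [Finsupp.mem_supported'] at hz hz'
    ext l
    by_cases hl : l ∈ chains A
    · exact hz' l (not_le.2 (Nat.lt_succ_of_le (length_le_card_of_mem_chains hl)))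
    · exact hz l hl
  · intro n z hz hzn hz0
    obtain ⟨w, hw, hwz⟩ := h z hz hz0
    have hmem := truncate_mem_supported (n + 1) hw
    rw [Finsupp.supported_inter] at hmem
    exact ⟨truncate (n + 1) w, hmem.1, hmem.2, by rw [boundary_truncate, hwz, truncate_of_mem hzn]⟩

end Action

end OrderChain

/-! ### The Lefschetz fixed point theorem -/

namespace OrderChain

section Trace

/-- An exact differential on a vector space has a contracting homotopy. -/
theorem exists_contraction {k M : Type*} [Field k] [AddCommGroup M] [Module k M]
    (d : Module.End k M) (hdd : d * d = 0) (hex : ∀ z, d z = 0 → ∃ w, d w = z) :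
    ∃ s : Module.End k M, d * s + s * d = 1 := by
  obtain ⟨t, ht⟩ := d.rangeRestrict.exists_rightInverse_of_surjective d.range_rangeRestrict
  obtain ⟨π, hπ⟩ := (LinearMap.range d).subtype.exists_leftInverse_of_injective
    (LinearMap.range d).ker_subtype
  have hs₀ : ∀ y, d ((t ∘ₗ π) (d y)) = d y := by
    intro y
    have h1 : π (d y) = ⟨d y, LinearMap.mem_range_self d y⟩ :=
      LinearMap.congr_fun hπ ⟨d y, LinearMap.mem_range_self d y⟩
    have h2 := congrArg Subtype.val (LinearMap.congr_fun ht ⟨d y, LinearMap.mem_range_self d y⟩)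
    rw [LinearMap.comp_apply, h1]
    exact h2
  have hd : ∀ y, d (d y) = 0 := LinearMap.congr_fun hdd
  generalize t ∘ₗ π = s₀ at hs₀
  refine ⟨s₀ - s₀ * s₀ * d, LinearMap.ext fun x => ?_⟩
  obtain ⟨w, hw⟩ := hex (x - s₀ (d x)) (by rw [map_sub, hs₀, sub_self])
  have h : d (s₀ (x - s₀ (d x))) = x - s₀ (d x) := by rw [← hw, hs₀]
  simp only [LinearMap.add_apply, Module.End.mul_apply, LinearMap.sub_apply, hd, map_zero, sub_zero,
    Module.End.one_apply]
  rw [← map_sub s₀, h, sub_add_cancel]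

/-- The Hopf trace formula for an exact complex: a chain map has supertrace zero. The grading
enters only through the sign operator `ε`. -/
theorem trace_eq_zero_of_exact {k M : Type*} [Field k] [AddCommGroup M] [Module k M]
    (d ε g : Module.End k M) (hdd : d * d = 0) (hex : ∀ z, d z = 0 → ∃ w, d w = z)
    (hε : d * ε = -(ε * d)) (hg : d * g = g * d) : LinearMap.trace k M (ε * g) = 0 := by
  obtain ⟨s, hs⟩ := exists_contraction d hdd hex
  have h1 : ε * g = ε * g * d * s + ε * g * s * d := by
    rw [mul_assoc (ε * g), mul_assoc (ε * g), ← mul_add, hs, mul_one]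
  have h2 : d * (ε * g * s) = -(ε * g * d * s) := by
    rw [← mul_assoc, ← mul_assoc, hε, neg_mul, neg_mul, mul_assoc ε, hg]
    simp only [mul_assoc]
  rw [h1, map_add, LinearMap.trace_mul_comm k (ε * g * s), h2, map_neg, add_neg_cancel]

variable {X : Type*} {k : Type*} [Field k]

theorem trace_restrict_supported {α : Type*} {s : Set α} [Fintype s] (φ : Module.End k (α →₀ k))
    (hφ : ∀ z ∈ Finsupp.supported k k s, φ z ∈ Finsupp.supported k k s) :
    LinearMap.trace k (Finsupp.supported k k s) (φ.restrict hφ) =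
      ∑ l : s, φ (Finsupp.single l.1 1) l.1 := by
  classical
  let b : Module.Basis s k (Finsupp.supported k k s) :=
    Module.Basis.ofRepr (Finsupp.supportedEquivFinsupp s)
  have hb : ∀ l, (b l).1 = Finsupp.single l.1 1 := fun l =>
    Finsupp.supportedEquivFinsupp_symm_single s l 1
  rw [LinearMap.trace_eq_matrix_trace k b, Matrix.trace]
  refine Finset.sum_congr rfl fun l _ => ?_
  rw [Matrix.diag_apply, LinearMap.toMatrix_apply, ← hb]
  rfl

variable (k) in
/-- The operator that multiplies each list by `(-1) ^ n`, where `n` is its length. -/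
noncomputable def signOperator : Module.End k (List X →₀ k) :=
  Finsupp.linearCombination k (fun l => Finsupp.single l ((-1) ^ l.length))

theorem signOperator_single (l : List X) (c : k) :
    signOperator k (Finsupp.single l c) = ((-1 : k) ^ l.length) • Finsupp.single l c := by
  simp [signOperator, mul_comm]

theorem signOperator_boundary (z : List X →₀ k) :
    boundary k (signOperator k z) = -signOperator k (boundary k z) := by
  induction z using Finsupp.induction_linear with
  | zero => simp
  | add f g hf hg => simp only [map_add, hf, hg, neg_add]
  | single l c =>
    rw [signOperator_single, map_smul, boundary_single, map_smul, smul_comm, ← smul_neg]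
    congr 1
    have h := boundaryList_mem (R := k) l
    rw [Finsupp.supported_eq_span_single] at h
    have key := LinearMap.eqOn_span (f := ((-1 : k) ^ l.length) • (LinearMap.id : Module.End k _))
      (g := -signOperator k) ?_ h
    · exact key
    rintro _ ⟨m, ⟨-, hm⟩, rfl⟩
    simp [signOperator_single, ← hm, pow_succ]

variable [PartialOrder X]

theorem finite_chains [Finite X] (A : Set X) : (chains A).Finite := by
  have := Fintype.ofFinite X
  exact (List.finite_length_le X (Nat.card X)).subset fun l hl => length_le_card_of_mem_chains hl

/-- A Lefschetz fixed point theorem: an automorphism of an acyclic finite poset has a fixed point.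
Without one, the empty chain alone would contribute to the supertrace. -/
theorem Acyclic.exists_fixedPoint [Finite X] {A : Set X} (g : X ≃o X)
    (hA : ∀ x, g x ∈ A ↔ x ∈ A) (h : Acyclic k A) : ∃ x ∈ A, g x = x := by
  classical
  by_contra! hfix
  have := (finite_chains A).fintype
  let γ : Module.End k (List X →₀ k) := Finsupp.lmapDomain k k (List.map g)
  have γ_single : ∀ l, γ (Finsupp.single l 1) = Finsupp.single (l.map g) 1 := fun l =>
    Finsupp.mapDomain_single
  have hε : ∀ z ∈ Finsupp.supported k k (chains A),
      signOperator k z ∈ Finsupp.supported k k (chains A) := fun z hz =>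
    map_mem_supported _ (fun l hl => by
      rw [signOperator_single]
      exact Submodule.smul_mem _ _ (Finsupp.single_mem_supported k _ hl)) hz
  have hγ : ∀ z ∈ Finsupp.supported k k (chains A),
      γ z ∈ Finsupp.supported k k (chains A) := fun z hz =>
    map_mem_supported _ (fun l hl => by
      rw [γ_single]
      exact Finsupp.single_mem_supported k _ ((map_mem_chains_iff g hA l).2 hl)) hz
  let d : Module.End k (Finsupp.supported k k (chains A)) :=
    (boundary k).restrict fun _ => boundary_mem_chains
  have hex : ∀ z, d z = 0 → ∃ w, d w = z := by
    intro z hz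
    obtain ⟨w, hw, hwz⟩ := h z.1 z.2 (congrArg Subtype.val hz)
    exact ⟨⟨w, hw⟩, Subtype.ext hwz⟩
  let ε' : Module.End k (Finsupp.supported k k (chains A)) := (signOperator k).restrict hε
  let γ' : Module.End k (Finsupp.supported k k (chains A)) := γ.restrict hγ
  have htrace : LinearMap.trace k (Finsupp.supported k k (chains A)) (ε' * γ') = 0 :=
    trace_eq_zero_of_exact (M := Finsupp.supported k k (chains A)) d ε' γ'
      (LinearMap.ext fun z => Subtype.ext (boundary_boundary z.1)) hex
      (LinearMap.ext fun z => Subtype.ext (signOperator_boundary z.1))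
      (LinearMap.ext fun z => Subtype.ext (boundary_lmapDomain_map _ z.1))
  have hmul : ε' * γ' = (signOperator k * γ).restrict fun z hz => hε _ (hγ z hz) := rfl
  have hnil : ([] : List X) ∈ chains A := ⟨List.Pairwise.nil, by simp⟩
  rw [hmul, trace_restrict_supported,
    Finset.sum_eq_single_of_mem ⟨[], hnil⟩ (Finset.mem_univ _)] at htrace
  · rw [Module.End.mul_apply, γ_single] at htrace
    simp [signOperator_single] at htrace
  · rintro ⟨l, hl⟩ - hne
    rw [Module.End.mul_apply, γ_single, signOperator_single, Finsupp.smul_apply,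
      Finsupp.single_eq_of_ne, smul_zero]
    intro hgl
    cases l with
    | nil => exact hne rfl
    | cons a l => exact hfix a (hl.2 a (by simp)) ((map_eq_self_iff g _).1 hgl.symm a (by simp))

end Trace

end OrderChain

/-! ### From decision trees to acyclic complexes -/

namespace OrderChain

section SimplicialComplex

variable {E : Type*} {R : Type*} [CommRing R]

theorem acyclic_union_of_isLowerSet {P Q : Set (Finset E)} (hP : IsLowerSet P) (hQ : IsLowerSet Q)
    (aP : Acyclic R (P \ {∅})) (aQ : Acyclic R (Q \ {∅})) (aPQ : Acyclic R ((P ∩ Q) \ {∅})) :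
    Acyclic R ((P ∪ Q) \ {∅}) := by
  rw [Set.union_sdiff_distrib]
  refine Acyclic.union (fun u hu v hv hvu => ⟨hP hvu hu.1, hv.2⟩)
    (fun v hv u hu huv => ⟨hQ huv hv.1, hu.2⟩) aP aQ ?_
  convert! aPQ using 1
  grind

/-- The face poset of a simplicial cone with apex `x` is acyclic. A largest face `M` and its facet
`M \ {x}` are removed by an elementary collapse, and what remains meets the simplex `M` in a smaller
cone with apex `x`. -/
theorem acyclic_cone [Finite E] [DecidableEq E] (x : E) (Q : Set (Finset E)) (hQ : IsLowerSet Q)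
    (hne : Q.Nonempty) (hx : ∀ S ∈ Q, insert x S ∈ Q) : Acyclic R (Q \ {∅}) := by
  induction hn : Q.ncard using Nat.strong_induction_on generalizing Q with
  | _ n ih =>
  obtain ⟨M, hM, hmax⟩ := Set.exists_max_image Q Finset.card Q.toFinite hne
  have heq : ∀ S ∈ Q, M ⊆ S → S = M := fun S hS h =>
    (Finset.eq_of_subset_of_card_le h (hmax S hS)).symm
  have hxM : x ∈ M := by
    rw [← heq _ (hx M hM) (Finset.subset_insert x M)]
    exact Finset.mem_insert_self x M
  have hM0 : M ≠ ∅ := Finset.ne_empty_of_mem hxM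
  by_cases htop : ∀ S ∈ Q, S ⊆ M
  · exact acyclic_of_isGreatest (m := M) ⟨⟨hM, hM0⟩, fun S hS => htop S hS.1⟩
  push Not at htop
  obtain ⟨S₀, hS₀, hS₀M⟩ := htop
  let U : Set (Finset E) := Q \ {M, M.erase x}
  have hS₀U : S₀ ∈ U := by
    refine ⟨hS₀, ?_⟩
    rintro (rfl | rfl)
    · exact hS₀M subset_rfl
    · exact hS₀M (Finset.erase_subset _ _)
  have hU : IsLowerSet U := by
    rintro S T hTS ⟨hS, hS'⟩
    refine ⟨hQ hTS hS, ?_⟩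
    rintro (rfl | rfl)
    · exact hS' (Or.inl (heq S hS hTS))
    · have h := heq _ (hx S hS) (by
        rw [← Finset.insert_erase hxM]
        exact Finset.insert_subset_insert x hTS)
      by_cases hxS : x ∈ S
      · rw [Finset.insert_eq_of_mem hxS] at h
        exact hS' (Or.inl h)
      · exact hS' (Or.inr (by rw [Set.mem_singleton_iff, ← h, Finset.erase_insert hxS]))
  have hxU : ∀ S ∈ U, insert x S ∈ U := by
    rintro S ⟨hS, hS'⟩
    refine ⟨hx S hS, ?_⟩
    rintro (h | h)
    · by_cases hxS : x ∈ S
      · rw [Finset.insert_eq_of_mem hxS] at h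
        exact hS' (Or.inl h)
      · exact hS' (Or.inr (by rw [Set.mem_singleton_iff, ← h, Finset.erase_insert hxS]))
    · exact Finset.notMem_erase x M (h ▸ Finset.mem_insert_self x S)
  have hUlt : U.ncard < n := by
    rw [← hn]
    exact Set.ncard_lt_ncard ⟨Set.sdiff_subset, fun h => (h hM).2 (Or.inl rfl)⟩ Q.toFinite
  have hunion : U ∪ Set.Iic M = Q := by
    ext S
    constructor
    · rintro (h | h)
      · exact h.1
      · exact hQ h hM
    · intro h
      by_cases hSM : S ⊆ M
      · exact Or.inr hSM
      · refine Or.inl ⟨h, ?_⟩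
        rintro (rfl | rfl)
        · exact hSM subset_rfl
        · exact hSM (Finset.erase_subset _ _)
  rw [← hunion]
  refine acyclic_union_of_isLowerSet hU (isLowerSet_Iic M) (ih _ hUlt U hU ⟨S₀, hS₀U⟩ hxU rfl)
    (acyclic_of_isGreatest (m := M) ⟨⟨Set.self_mem_Iic, hM0⟩, fun S hS => hS.1⟩)
    (ih _ ((Set.ncard_le_ncard Set.inter_subset_left (Set.toFinite U)).trans_lt hUlt)
      (U ∩ Set.Iic M) (hU.inter (isLowerSet_Iic M))
      ⟨∅, hU (Finset.empty_subset S₀) hS₀U, Finset.empty_subset M⟩ ?_ rfl)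
  rintro S ⟨hS, hSM⟩
  exact ⟨hxU S hS, Finset.insert_subset hxM hSM⟩

/-- A complex is the union of the deletion of `e` and the star of `e`, which meet in the link. -/
theorem acyclic_of_deletion_of_link [Finite E] [DecidableEq E] (e : E) {F : Set (Finset E)}
    (hF : IsLowerSet F) (hdel : Acyclic R ({S | e ∉ S ∧ S ∈ F} \ {∅}))
    (hlink : {S | e ∉ S ∧ insert e S ∈ F} = ∅ ∨
      Acyclic R ({S | e ∉ S ∧ insert e S ∈ F} \ {∅})) : Acyclic R (F \ {∅}) := by
  have hdelF : IsLowerSet {S | e ∉ S ∧ S ∈ F} := fun S T hTS hS =>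
    ⟨fun h => hS.1 (hTS h), hF hTS hS.2⟩
  let star : Set (Finset E) := {S | insert e S ∈ F}
  have hstar : IsLowerSet star := fun S T hTS hS => hF (Finset.insert_subset_insert e hTS) hS
  have hunion : {S | e ∉ S ∧ S ∈ F} ∪ star = F := by
    ext S
    constructor
    · rintro (h | h)
      · exact h.2
      · exact hF (Finset.subset_insert e S) h
    · intro h
      by_cases he : e ∈ S
      · exact Or.inr (by rwa [Set.mem_ofPred_eq, Finset.insert_eq_of_mem he])
      · exact Or.inl ⟨he, h⟩
  have hinter : {S | e ∉ S ∧ S ∈ F} ∩ star = {S | e ∉ S ∧ insert e S ∈ F} := by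
    ext S
    constructor
    · rintro ⟨h1, h2⟩
      exact ⟨h1.1, h2⟩
    · rintro ⟨h1, h2⟩
      exact ⟨⟨h1, hF (Finset.subset_insert e S) h2⟩, h2⟩
  rcases star.eq_empty_or_nonempty with hs | hs
  · rwa [← hunion, hs, Set.union_empty]
  · have hcone : Acyclic R (star \ {∅}) := acyclic_cone e star hstar hs fun S hS => by
      simpa [star] using hS
    rw [← hunion]
    refine acyclic_union_of_isLowerSet hdelF hstar hdel hcone ?_
    rw [hinter]
    refine hlink.resolve_left fun h => ?_
    obtain ⟨S, hS⟩ := hs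
    have : S.erase e ∈ {S | e ∉ S ∧ insert e S ∈ F} :=
      ⟨Finset.notMem_erase e S,
        hF (Finset.insert_subset (Finset.mem_insert_self e S)
          ((Finset.erase_subset e S).trans (Finset.subset_insert e S))) hS⟩
    rw [h] at this
    exact this

end SimplicialComplex

end OrderChain

section DecisionTrees

variable {V : Type*}

/-- The graph with the given set of edges. -/
def graphOfEdges (S : Finset (PotentialEdge V)) : SimpleGraph V :=
  SimpleGraph.fromEdgeSet (Subtype.val '' (S : Set (PotentialEdge V)))

theorem mem_edgeSet_graphOfEdges (S : Finset (PotentialEdge V)) (e : PotentialEdge V) :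
    (e : Sym2 V) ∈ (graphOfEdges S).edgeSet ↔ e ∈ S := by
  simp only [graphOfEdges, SimpleGraph.edgeSet_fromEdgeSet]
  simp [e.2]

open Classical in
/-- On the subcube in which the edges of `D` are present and those of `R` are free, a tree too
shallow to query all of `R` can only define a simplicial complex that is void or acyclic. -/
theorem DecisionTree.eq_empty_or_acyclic {k : Type*} [CommRing k] [Finite V] (T : DecisionTree V)
    (b : Bool) (D R : Finset (PotentialEdge V)) (hDR : Disjoint D R) (hdepth : T.depth < R.card)
    (hlow : IsLowerSet {S | S ⊆ R ∧ T.eval (graphOfEdges (S ∪ D)) = b}) :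
    {S | S ⊆ R ∧ T.eval (graphOfEdges (S ∪ D)) = b} = ∅ ∨
      OrderChain.Acyclic k ({S | S ⊆ R ∧ T.eval (graphOfEdges (S ∪ D)) = b} \ {∅}) := by
  induction T generalizing D R with
  | leaf c =>
    by_cases hcb : c = b
    · right
      refine OrderChain.acyclic_of_isGreatest (m := R) ⟨⟨⟨subset_rfl, hcb⟩, ?_⟩, fun S hS => hS.1.1⟩
      rintro rfl
      simp at hdepth
    · left
      ext S
      simp [DecisionTree.eval, hcb]
  | query e no yes ihn ihy =>
    rw [DecisionTree.depth] at hdepth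
    by_cases heR : e ∈ R
    · have heD : e ∉ D := fun h => Finset.disjoint_left.1 hDR h heR
      set F := {S | S ⊆ R ∧ (query e no yes).eval (graphOfEdges (S ∪ D)) = b} with hFdef
      have hcard := Finset.card_erase_of_mem heR
      have hdel : {S | S ⊆ R.erase e ∧ no.eval (graphOfEdges (S ∪ D)) = b} =
          {S | e ∉ S ∧ S ∈ F} := by
        ext S
        simp only [Set.mem_ofPred_eq, hFdef, Finset.subset_erase, DecisionTree.eval,
          mem_edgeSet_graphOfEdges, Finset.mem_union, heD, or_false]
        by_cases heS : e ∈ S <;> simp [heS]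
      have hlink : {S | S ⊆ R.erase e ∧ yes.eval (graphOfEdges (S ∪ insert e D)) = b} =
          {S | e ∉ S ∧ insert e S ∈ F} := by
        ext S
        simp only [Set.mem_ofPred_eq, hFdef, Finset.subset_erase, DecisionTree.eval,
          mem_edgeSet_graphOfEdges, Finset.mem_union, Finset.mem_insert, true_or, if_true,
          Finset.insert_subset_iff, heR, true_and, Finset.union_insert, Finset.insert_union]
        tauto
      have hn := ihn D (R.erase e) (hDR.mono_right (Finset.erase_subset e R)) (by omega) (by
        rw [hdel]
        exact fun S T hTS hS => ⟨fun h => hS.1 (hTS h), hlow hTS hS.2⟩)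
      have hy := ihy (insert e D) (R.erase e) (by
        rw [Finset.disjoint_insert_left]
        exact ⟨Finset.notMem_erase e R, hDR.mono_right (Finset.erase_subset e R)⟩) (by omega) (by
        rw [hlink]
        exact fun S T hTS hS =>
          ⟨fun h => hS.1 (hTS h), hlow (Finset.insert_subset_insert e hTS) hS.2⟩)
      rw [hdel] at hn
      rw [hlink] at hy
      rcases F.eq_empty_or_nonempty with h | ⟨S, hS⟩
      · exact Or.inl h
      · refine Or.inr
          (OrderChain.acyclic_of_deletion_of_link e hlow (hn.resolve_left fun h => ?_) hy)
        have : ∅ ∈ {S | e ∉ S ∧ S ∈ F} :=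
          ⟨Finset.notMem_empty e, hlow (Finset.empty_subset S) hS⟩
        rw [h] at this
        exact this
    · by_cases heD : e ∈ D
      · have heq : {S | S ⊆ R ∧ (query e no yes).eval (graphOfEdges (S ∪ D)) = b} =
            {S | S ⊆ R ∧ yes.eval (graphOfEdges (S ∪ D)) = b} := by
          ext S
          simp [DecisionTree.eval, mem_edgeSet_graphOfEdges, heD]
        rw [heq] at hlow ⊢
        exact ihy D R hDR (by omega) hlow
      · have heq : {S | S ⊆ R ∧ (query e no yes).eval (graphOfEdges (S ∪ D)) = b} =
            {S | S ⊆ R ∧ no.eval (graphOfEdges (S ∪ D)) = b} := by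
          ext S
          simp only [Set.mem_ofPred_eq, DecisionTree.eval, mem_edgeSet_graphOfEdges,
            Finset.mem_union, heD, or_false]
          refine and_congr_right fun hS => ?_
          rw [if_neg fun h => heR (hS h)]
        rw [heq] at hlow ⊢
        exact ihn D R hDR (by omega) hlow

end DecisionTrees

/-! ### The affine group and evasiveness -/

namespace OrderChain

/-- The affine group of a finite field has a normal `p`-subgroup, the translations, with cyclic
quotient, so every action of it on a finite poset that is acyclic mod `p` has a fixed point. -/
theorem Acyclic.exists_fixedPoint_of_affine {X : Type*} [PartialOrder X] [Finite X] (p : ℕ)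
    [Fact p.Prime] {K : Type*} [Field K] [Finite K] [CharP K p]
    (ρ : Equiv.Perm K →* (X ≃o X)) {A : Set X} (hA : ∀ σ x, ρ σ x ∈ A ↔ x ∈ A)
    (h : Acyclic (ZMod p) A) :
    ∃ x ∈ A, (∀ b, ρ (Equiv.addRight b) x = x) ∧ ∀ c, ρ (MulAction.toPermHom Kˣ K c) x = x := by
  classical
  have hmul : ∀ σ τ x, ρ σ (ρ τ x) = ρ (σ * τ) x := fun σ τ x => by rw [map_mul]; rfl
  have htrans : ∀ B : Finset K,
      Acyclic (ZMod p) {x | x ∈ A ∧ ∀ b ∈ B, ρ (Equiv.addRight b) x = x} := by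
    intro B
    induction B using Finset.induction_on with
    | empty => simpa using h
    | insert b B _ ih =>
      have := ih.fixedPoints (ρ (Equiv.addRight b)) ?_ ?_
      · convert this using 1
        ext x
        simp only [Finset.forall_mem_insert, Set.mem_ofPred_eq]
        tauto
      · intro x
        have hpow : ∀ n : ℕ, (ρ (Equiv.addRight b))^[n] x = ρ (Equiv.addRight b ^ n) x := by
          intro n
          induction n with
          | zero => simp
          | succ n ih => rw [Function.iterate_succ_apply', ih, hmul, pow_succ']
        rw [hpow, Equiv.nsmul_addRight, nsmul_eq_mul, CharP.cast_eq_zero, zero_mul,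
          Equiv.addRight_zero, map_one]
        rfl
      · intro x
        have hcomm : ∀ c, ρ (Equiv.addRight c) (ρ (Equiv.addRight b) x) =
            ρ (Equiv.addRight b) (ρ (Equiv.addRight c) x) := by
          intro c
          rw [hmul, hmul]
          congr 2
          ext y
          simp [add_right_comm]
        simp only [Set.mem_ofPred_eq, hA, hcomm, EmbeddingLike.apply_eq_iff_eq]
  have := Fintype.ofFinite K
  obtain ⟨ζ, hζ⟩ := IsCyclic.exists_monoid_generator (α := Kˣ)
  obtain ⟨x, ⟨hxA, hx⟩, hζx⟩ := (htrans Finset.univ).exists_fixedPoint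
    (ρ (MulAction.toPermHom Kˣ K ζ)) (fun x => by
      have hconj : ∀ b, ρ (Equiv.addRight (ζ * b)) (ρ (MulAction.toPermHom Kˣ K ζ) x) =
          ρ (MulAction.toPermHom Kˣ K ζ) (ρ (Equiv.addRight b) x) := by
        intro b
        rw [hmul, hmul]
        congr 2
        ext y
        simp [Units.smul_def]
      simp only [Set.mem_ofPred_eq, hA, Finset.mem_univ, true_implies]
      refine and_congr_right fun _ => ⟨fun hx b => ?_, fun hx b => ?_⟩
      · have := hconj b
        rwa [hx, EmbeddingLike.apply_eq_iff_eq, eq_comm] at this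
      · have := hconj (ζ⁻¹ * b)
        rwa [hx, Units.mul_inv_cancel_left] at this)
  refine ⟨x, hxA, fun b => hx b (Finset.mem_univ b), fun c => ?_⟩
  obtain ⟨n, rfl⟩ := hζ c
  induction n with
  | zero =>
    change ρ (MulAction.toPermHom Kˣ K (ζ ^ 0)) x = x
    rw [pow_zero, map_one, map_one]
    rfl
  | succ n ih =>
    change ρ (MulAction.toPermHom Kˣ K (ζ ^ (n + 1))) x = x
    rw [pow_succ, map_mul, ← hmul, hζx]
    exact ih

end OrderChain

section Evasiveness

variable {V : Type*}

/-- The action of a permutation of the vertices on the potential edges. -/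
def edgePerm (π : Equiv.Perm V) : Equiv.Perm (PotentialEdge V) where
  toFun e := ⟨e.1.map π, (Sym2.isDiag_map π.injective).not.2 e.2⟩
  invFun e := ⟨e.1.map π.symm, (Sym2.isDiag_map π.symm.injective).not.2 e.2⟩
  left_inv e := Subtype.ext (by simp [Sym2.map_map])
  right_inv e := Subtype.ext (by simp [Sym2.map_map])

/-- The action of the permutations of the vertices on the edge sets of graphs. -/
def edgeSetAction : Equiv.Perm V →* (Finset (PotentialEdge V) ≃o Finset (PotentialEdge V)) where
  toFun π :=
    { toEquiv := (edgePerm π).finsetCongr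
      map_rel_iff' := Finset.map_subset_map }
  map_one' := by
    have hone : edgePerm (1 : Equiv.Perm V) = Equiv.refl _ :=
      Equiv.ext fun e => Subtype.ext (by simp [edgePerm])
    refine RelIso.ext fun S => ?_
    change S.map (edgePerm 1).toEmbedding = S
    rw [hone]
    exact Finset.map_refl
  map_mul' π τ := by
    have hmul : edgePerm (π * τ) = (edgePerm τ).trans (edgePerm π) :=
      Equiv.ext fun e => Subtype.ext (by simp [edgePerm, Sym2.map_map])
    refine RelIso.ext fun S => ?_
    change S.map (edgePerm (π * τ)).toEmbedding =
      (S.map (edgePerm τ).toEmbedding).map (edgePerm π).toEmbedding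
    rw [hmul, Finset.map_map]
    rfl

theorem mem_edgeSetAction {π : Equiv.Perm V} {S : Finset (PotentialEdge V)} {e : PotentialEdge V} :
    edgePerm π e ∈ edgeSetAction π S ↔ e ∈ S := by
  change edgePerm π e ∈ S.map (edgePerm π).toEmbedding ↔ e ∈ S
  simp

theorem graphOfEdges_adj (S : Finset (PotentialEdge V)) (u v : V) :
    (graphOfEdges S).Adj u v ↔ ∃ h : ¬ s(u, v).IsDiag, ⟨s(u, v), h⟩ ∈ S := by
  constructor
  · intro h
    have hd : ¬ s(u, v).IsDiag := by simpa using h.ne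
    exact ⟨hd, (mem_edgeSet_graphOfEdges S ⟨s(u, v), hd⟩).1 h⟩
  · rintro ⟨h, hS⟩
    exact (mem_edgeSet_graphOfEdges S ⟨s(u, v), h⟩).2 hS

theorem graphOfEdges_empty : graphOfEdges (∅ : Finset (PotentialEdge V)) = ⊥ := by
  simp [graphOfEdges]

theorem graphOfEdges_univ [Fintype (PotentialEdge V)] :
    graphOfEdges (Finset.univ : Finset (PotentialEdge V)) = ⊤ := by
  ext u v
  simp [graphOfEdges_adj]

theorem edgeSet_graphOfEdges_mono {S T : Finset (PotentialEdge V)} (h : S ⊆ T) :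
    (graphOfEdges S).edgeSet ⊆ (graphOfEdges T).edgeSet :=
  SimpleGraph.edgeSet_mono (SimpleGraph.fromEdgeSet_mono (Set.image_mono (by exact_mod_cast h)))

theorem IsGraphProperty.apply_edgeSetAction {h : SimpleGraph V → Bool} (hprop : IsGraphProperty h)
    (π : Equiv.Perm V) (S : Finset (PotentialEdge V)) :
    h (graphOfEdges (edgeSetAction π S)) = h (graphOfEdges S) := by
  refine (hprop _ _ ⟨⟨π, fun {u v} => ?_⟩⟩).symm
  rw [graphOfEdges_adj, graphOfEdges_adj]
  constructor
  · rintro ⟨hd, hS⟩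
    have hd' : ¬ s(u, v).IsDiag := fun h => hd (by simpa using h)
    exact ⟨hd', mem_edgeSetAction.1 hS⟩
  · rintro ⟨hd, hS⟩
    exact ⟨fun h => hd (by simpa using h), mem_edgeSetAction.2 hS⟩

/-- The affine group is transitive on the pairs of distinct points of a field, so a nonempty
invariant set of edges contains every edge. -/
theorem mem_of_affine_invariant {K : Type*} [Field K] (φ : V ≃ K) {S : Finset (PotentialEdge V)}
    (hadd : ∀ b, edgeSetAction (φ.symm.permCongrHom (Equiv.addRight b)) S = S)
    (hmul : ∀ c, edgeSetAction (φ.symm.permCongrHom (MulAction.toPermHom Kˣ K c)) S = S)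
    (hne : S.Nonempty) (e : PotentialEdge V) : e ∈ S := by
  have hedge : ∀ π, edgeSetAction π S = S → ∀ f ∈ S, edgePerm π f ∈ S := by
    intro π hπ f hf
    rw [← hπ]
    exact mem_edgeSetAction.2 hf
  obtain ⟨⟨f, hf⟩, hfS⟩ := hne
  obtain ⟨e, he⟩ := e
  induction f using Sym2.ind with | _ u v =>
  induction e using Sym2.ind with | _ u' v' =>
  have huv : φ v - φ u ≠ 0 := sub_ne_zero.2 fun h => hf (by simpa using (φ.injective h).symm)
  have huv' : φ v' - φ u' ≠ 0 := sub_ne_zero.2 fun h => he (by simpa using (φ.injective h).symm)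
  have := hedge _ (hadd (φ u')) _ (hedge _ (hmul (Units.mk0 _ huv' / Units.mk0 _ huv)) _
    (hedge _ (hadd (-φ u)) _ hfS))
  convert this using 1
  apply Subtype.ext
  change s(u', v') = s(_, _)
  congr 1
  · simp [Equiv.permCongrHom, Equiv.permCongr_apply]
  · simp [Equiv.permCongrHom, Equiv.permCongr_apply, Units.smul_def, ← sub_eq_add_neg, huv]

/-- A nontrivial monotone property separates the two extreme graphs, and the graphs on which it
agrees with the empty graph form a simplicial complex. -/
theorem bot_ne_top_and_isLowerSet {h : SimpleGraph V → Bool}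
    (hmono : IsMonotoneIncreasing h ∨ IsMonotoneDecreasing h) (hnontriv : IsNontrivialProperty h) :
    h ⊥ ≠ h ⊤ ∧ IsLowerSet {S | h (graphOfEdges S) = h ⊥} := by
  obtain ⟨G, G', hG⟩ := hnontriv
  have hbot : ∀ G : SimpleGraph V, (⊥ : SimpleGraph V).edgeSet ⊆ G.edgeSet := by simp
  have htop : ∀ G : SimpleGraph V, G.edgeSet ⊆ (⊤ : SimpleGraph V).edgeSet := fun G =>
    SimpleGraph.edgeSet_mono le_top
  rcases hmono with hm | hm
  · refine ⟨fun heq => hG ?_, fun T S hST hT => ?_⟩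
    · have hconst : ∀ G, h G = h ⊥ := fun G =>
        le_antisymm (heq ▸ hm _ _ (htop G)) (hm _ _ (hbot G))
      rw [hconst G, hconst G']
    · exact le_antisymm ((hm _ _ (edgeSet_graphOfEdges_mono hST)).trans_eq hT) (hm _ _ (hbot _))
  · refine ⟨fun heq => hG ?_, fun T S hST hT => ?_⟩
    · have hconst : ∀ G, h G = h ⊥ := fun G =>
        le_antisymm (hm _ _ (hbot G)) (heq ▸ hm _ _ (htop G))
      rw [hconst G, hconst G']
    · exact le_antisymm (hm _ _ (hbot _)) (hT.symm.trans_le (hm _ _ (edgeSet_graphOfEdges_mono hST)))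

end Evasiveness

theorem mainTheorem1 {V : Type*} [Fintype V] (p k : ℕ) (hp : p.Prime) (hk : 1 ≤ k)
    (hV : Fintype.card V = p ^ k) (h : SimpleGraph V → Bool)
    (hprop : IsGraphProperty h) (hmono : IsMonotoneIncreasing h ∨ IsMonotoneDecreasing h)
    (hnontriv : IsNontrivialProperty h) :
    IsEvasive h := by
  classical
  have := Fact.mk hp
  obtain ⟨T₀, hT₀, hd₀⟩ := exists_computes_depth_le h
  have hmem : T₀.depth ∈ {d : ℕ | ∃ T : DecisionTree V, T.Computes h ∧ T.depth = d} :=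
    ⟨T₀, hT₀, rfl⟩
  refine le_antisymm ((Nat.sInf_le hmem).trans hd₀) ?_
  by_contra! hlt
  obtain ⟨T, hT, hTd⟩ := Nat.sInf_mem ⟨_, hmem⟩
  obtain ⟨hne, hlow⟩ := bot_ne_top_and_isLowerSet hmono hnontriv
  have hF : {S | S ⊆ Finset.univ ∧ T.eval (graphOfEdges (S ∪ ∅)) = h ⊥} =
      {S | h (graphOfEdges S) = h ⊥} := by
    ext S
    simp [hT _]
  have hacyc := T.eq_empty_or_acyclic (k := ZMod p) (h ⊥) ∅ Finset.univ
    (Finset.disjoint_empty_left _)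
    (by
      rw [Finset.card_univ, Sym2.card_subtype_not_diag]
      exact hTd.trans_lt hlt)
    (by rwa [hF])
  rw [hF] at hacyc
  have hvoid : (∅ : Finset (PotentialEdge V)) ∈ {S | h (graphOfEdges S) = h ⊥} := by
    simp [graphOfEdges_empty]
  replace hacyc := hacyc.resolve_left (Set.nonempty_of_mem hvoid).ne_empty
  have : Finite (GaloisField p k) := inferInstance
  obtain ⟨φ⟩ : Nonempty (V ≃ GaloisField p k) := by
    rw [← Finite.card_eq, GaloisField.card p k (by omega), Nat.card_eq_fintype_card, hV]
  obtain ⟨S, ⟨hS, hS0⟩, hadd, hmul⟩ := hacyc.exists_fixedPoint_of_affine p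
    (edgeSetAction.comp φ.symm.permCongrHom.toMonoidHom) (fun σ S => by
      have hempty : edgeSetAction (φ.symm.permCongrHom σ) S = ∅ ↔ S = ∅ := Finset.map_eq_empty
      refine and_congr ?_ (not_congr hempty)
      change h (graphOfEdges (edgeSetAction (φ.symm.permCongrHom σ) S)) = h ⊥ ↔ _
      rw [hprop.apply_edgeSetAction]
      rfl)
  have huniv : S = Finset.univ := Finset.eq_univ_of_forall
    (mem_of_affine_invariant φ hadd hmul (Finset.nonempty_iff_ne_empty.2 hS0))
  rw [huniv, Set.mem_ofPred_eq, graphOfEdges_univ] at hS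
  exact hne hS.symm
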